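/- There is a universal constant $c > 0$ with the following property. Let $(\mathcal{M}, g)$ be a non-empty compact smooth $d$-dimensional Riemannian manifold without boundary, with geodesic distance $d_g$ and Riemannian volume $\mathrm{Vol}$, such that all sectional curvatures satisfy $\kappa_{\min} \le \sec \le \kappa_{\max}$, the injectivity radius $\mathrm{inj}(\mathcal{M})$ is positive, and $\mathrm{Vol}(\mathcal{M}) < \infty$. For $x \in \mathcal{M}$ and $r > 0$ let $B(x, r) = \{y \in \mathcal{M} : d_g(x, y) < r\}$, and let $N(\mathcal{M}, \epsilon, d_g)$ be the least number of balls $B(x, \epsilon)$, $x \in \mathcal{M}$, that cover $\mathcal{M}$. Then for every real $\epsilon$ with $0 < \epsilon < \frac{1}{2} \mathrm{inj}(\mathcal{M})$, the number $N(\mathcal{M}, \epsilon, d_g)$ is finite, $\inf_{x \in \mathcal{M}} \mathrm{Vol}(B(x, \epsilon/2)) > 0$, and \[ \log N(\mathcal{M}, \epsilon, d_g) \le \log \left( \frac{\mathrm{Vol}(\mathcal{M})}{\inf_{x \in \mathcal{M}} \mathrm{Vol}(B(x, \epsilon/2))} \right) + C \sqrt{|\kappa_{\max}|}\, \epsilon,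 \qquad C = c \cdot d . \] -/

import Mathlib

open MeasureTheory Bundle
open scoped Manifold ContDiff ENNReal

noncomputable section

namespace RiemannianCovering

section Riemannian

variable {d : ℕ} {M : Type*} [TopologicalSpace M] [ChartedSpace (EuclideanSpace ℝ (Fin d)) M]
  [RiemannianBundle (fun x : M => TangentSpace (𝓡 d) x)]

/-! ### The metric in local coordinates -/

/-- The coordinate vector `∂_i` of the chart around `p`, at the point of `M` whose coordinates in
that chart are `y`. -/
def coordVector (p : M) (y : EuclideanSpace ℝ (Fin d)) (i : Fin d) :
    TangentSpace (𝓡 d) ((extChartAt (𝓡 d) p).symm y) :=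
  mfderiv (𝓡 d) (𝓡 d) (extChartAt (𝓡 d) p).symm y (EuclideanSpace.single i (1 : ℝ))

/-- The matrix `(g_ij)` of the Riemannian metric in the chart around `p`, as a function of the
coordinates `y`. -/
def metricMatrix (p : M) (y : EuclideanSpace ℝ (Fin d)) : Matrix (Fin d) (Fin d) ℝ :=
  fun i j => inner ℝ (coordVector p y i) (coordVector p y j)

/-- Partial derivative of a function of the coordinates in the `i`-th direction. -/
def partialDeriv (i : Fin d) (f : EuclideanSpace ℝ (Fin d) → ℝ) (y : EuclideanSpace ℝ (Fin d)) :
    ℝ :=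
  fderiv ℝ f y (EuclideanSpace.single i (1 : ℝ))

/-- The Christoffel symbol `Γ^k_{ij}` of the Levi-Civita connection in the chart around `p`. -/
def christoffel (p : M) (k i j : Fin d) (y : EuclideanSpace ℝ (Fin d)) : ℝ :=
  (1 / 2) * ∑ l, (metricMatrix p y)⁻¹ k l *
    (partialDeriv i (fun z => metricMatrix p z j l) y
      + partialDeriv j (fun z => metricMatrix p z i l) y
      - partialDeriv l (fun z => metricMatrix p z i j) y)

/-- The component `R^l_{ijk}` of the Riemann curvature tensor in the chart around `p`, with the
convention `R(∂_i, ∂_j) ∂_k = ∇_i ∇_j ∂_k - ∇_j ∇_i ∂_k = ∑ l, R^l_{ijk} ∂_l`. -/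
def riemannTensor (p : M) (l i j k : Fin d) (y : EuclideanSpace ℝ (Fin d)) : ℝ :=
  partialDeriv i (christoffel p l j k) y - partialDeriv j (christoffel p l i k) y
    + ∑ m, (christoffel p m j k y * christoffel p l i m y
      - christoffel p m i k y * christoffel p l j m y)

/-- The components of a tangent vector at `p` in the chart around `p`. -/
def coordComponents (p : M) (u : TangentSpace (𝓡 d) p) : EuclideanSpace ℝ (Fin d) :=
  mfderiv (𝓡 d) (𝓡 d) (extChartAt (𝓡 d) p) p u

/-- The sectional curvature `⟨R(u, v) v, u⟩ / (|u|² |v|² - ⟨u, v⟩²)` of the plane spanned by two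
linearly independent tangent vectors `u`, `v` at `p`. -/
def sectionalCurvature (p : M) (u v : TangentSpace (𝓡 d) p) : ℝ :=
  (∑ i, ∑ j, ∑ k, ∑ l, ∑ m,
      coordComponents p u i * coordComponents p v j * coordComponents p v k *
        coordComponents p u m * metricMatrix p (extChartAt (𝓡 d) p p) l m *
        riemannTensor p l i j k (extChartAt (𝓡 d) p p))
    / (inner ℝ u u * inner ℝ v v - inner ℝ u v ^ 2)

/-! ### Geodesics, exponential map, injectivity radius -/

/-- The curve `γ` is a (complete) geodesic: it is smooth and satisfies the geodesic equation
`γ''^k + ∑ Γ^k_{ij} γ'^i γ'^j = 0` at every time `t`, in the chart around `γ t`. -/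
def IsGeodesic (γ : ℝ → M) : Prop :=
  ContMDiff 𝓘(ℝ, ℝ) (𝓡 d) ∞ γ ∧
  ∀ t : ℝ, ∀ k : Fin d,
    deriv (deriv fun s => extChartAt (𝓡 d) (γ t) (γ s) k) t
      + ∑ i, ∑ j, christoffel (γ t) k i j (extChartAt (𝓡 d) (γ t) (γ t))
          * deriv (fun s => extChartAt (𝓡 d) (γ t) (γ s) i) t
          * deriv (fun s => extChartAt (𝓡 d) (γ t) (γ s) j) t = 0

open Classical in
/-- The exponential map at `p`: the value at time `1` of the geodesic with initial point `p` and
initial velocity `v`. On a compact manifold this geodesic exists for all times and is unique, so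
the alternative value is never used there. -/
def expMap (p : M) (v : TangentSpace (𝓡 d) p) : M :=
  if h : ∃ γ : ℝ → M, IsGeodesic (d := d) γ ∧
      tangentMap 𝓘(ℝ, ℝ) (𝓡 d) γ ⟨0, (1 : ℝ)⟩ = (⟨p, v⟩ : TangentBundle (𝓡 d) M)
  then h.choose 1 else p

variable (d) in
/-- The injectivity radius at `p`: the supremum of the radii `r` such that `expMap p` maps the open
ball of radius `r` around `0` in the tangent space diffeomorphically onto its image, that is, it is
an injective local diffeomorphism there. -/
def injRadiusAt (p : M) : ℝ≥0∞ :=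
  sSup {r : ℝ≥0∞ | Set.InjOn (expMap (d := d) p) {v | ‖v‖ₑ < r} ∧
    IsLocalDiffeomorphOn 𝓘(ℝ, TangentSpace (𝓡 d) p) (𝓡 d) ∞ (expMap (d := d) p) {v | ‖v‖ₑ < r}}

variable (d M) in
/-- The injectivity radius of `M`. -/
def injRadius : ℝ≥0∞ := ⨅ p : M, injRadiusAt d p

/-! ### Riemannian volume -/

/-- The Riemannian volume on the domain of the chart around `p`: the image of the measure
`√(det g_ij) dy` on the range of the chart, extended by zero outside the domain. -/
def chartVolume [MeasurableSpace M] (p : M) : Measure M :=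
  ((volume.restrict (extChartAt (𝓡 d) p).target).withDensity
    (fun y => ENNReal.ofReal (Real.sqrt (metricMatrix p y).det))).map (extChartAt (𝓡 d) p).symm

variable (d M) in
/-- The Riemannian volume measure of `M`: the measure that restricts to `chartVolume p` on the
domain of the chart around `p`, for every `p`. Since chart volumes agree on overlaps and countably
many charts cover `M`, it is the least measure that dominates all of them. -/
def riemannianVolume [MeasurableSpace M] : Measure M := ⨆ p : M, chartVolume (d := d) p

end Riemannian

/-! ### Geodesic balls and covering numbers -/

section Covering

variable {X : Type*} [EMetricSpace X]

/-- The (open) ball of radius `r` around `x`. -/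
def geodesicBall (x : X) (r : ℝ) : Set X := {y | edist y x < ENNReal.ofReal r}

variable (X) in
/-- The covering number of `X` at scale `ε`: the least number of balls of radius `ε` that
cover `X`, and `⊤` if there is no finite cover. As the balls are open, it is at least as large as
the covering number by closed balls of the same radius. -/
def coveringNumber (ε : ℝ) : ℕ∞ :=
  ⨅ (s : Set X) (_ : (⋃ x ∈ s, geodesicBall x ε) = Set.univ), s.encard

end Covering

end RiemannianCovering

end

open Set Filter Topology

namespace RiemannianCovering

/-! ### Positivity of the Riemannian volume on open sets. -/

section Volume

variable {d : ℕ} {M : Type*} [TopologicalSpace M] [ChartedSpace (EuclideanSpace ℝ (Fin d)) M]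
  [IsManifold (𝓡 d) ∞ M] [RiemannianBundle (fun x : M => TangentSpace (𝓡 d) x)]

/-! The bound is a packing argument. In a largest ε-separated set the balls of radius ε/2 are
disjoint, so their number times the least volume of such a ball is at most the total volume; by
maximality the balls of radius ε cover (`coveringNumber_toNat_mul_iInf_measure_le`). The curvature
term is nonnegative and only enlarges the right side. The least volume is positive by compactness
(`iInf_measure_geodesicBall_pos`), once nonempty open sets have positive volume
(`riemannianVolume_pos`). -/

omit [RiemannianBundle (fun x : M => TangentSpace (𝓡 d) x)] in
/-- The coordinate vectors depend continuously on the point. -/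
lemma continuousOn_coordVector (p : M) (i : Fin d) :
    ContinuousOn (fun y => (⟨(extChartAt (𝓡 d) p).symm y, coordVector p y i⟩ :
      TangentBundle (𝓡 d) M)) (extChartAt (𝓡 d) p).target := by
  have hopen : IsOpen (extChartAt (𝓡 d) p).target := isOpen_extChartAt_target p
  -- The coordinate field is the image of a constant section under the tangent map of the inverse
  -- chart.
  have h1 := (contMDiffOn_extChartAt_symm (I := 𝓡 d) (n := ∞) p).continuousOn_tangentMapWithin
    (by simp) hopen.uniqueMDiffOn
  have h2 : Continuous (fun y : EuclideanSpace ℝ (Fin d) =>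
      (⟨y, EuclideanSpace.single i (1 : ℝ)⟩ :
        TangentBundle 𝓘(ℝ, EuclideanSpace ℝ (Fin d)) (EuclideanSpace ℝ (Fin d)))) := by
    have : Continuous (fun y : EuclideanSpace ℝ (Fin d) =>
      (y, (EuclideanSpace.single i (1 : ℝ) : EuclideanSpace ℝ (Fin d)))) := by fun_prop
    exact (tangentBundleModelSpaceHomeomorph
      𝓘(ℝ, EuclideanSpace ℝ (Fin d))).symm.continuous.comp this
  refine (h1.comp h2.continuousOn fun y hy => hy).congr fun y hy => ?_
  simp only [Function.comp_apply, tangentMapWithin, coordVector]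
  rw [mfderivWithin_of_isOpen hopen hy]

lemma continuousOn_metricMatrix
    [IsContMDiffRiemannianBundle (𝓡 d) ∞ (EuclideanSpace ℝ (Fin d))
      (fun x : M => TangentSpace (𝓡 d) x)] (p : M) :
    ContinuousOn (metricMatrix p) (extChartAt (𝓡 d) p).target := by
  refine continuousOn_pi.2 fun i => continuousOn_pi.2 fun j => ?_
  have : IsContinuousRiemannianBundle (EuclideanSpace ℝ (Fin d))
      (fun x : M => TangentSpace (𝓡 d) x) := by
    obtain ⟨g, hg, hinner⟩ := IsContMDiffRiemannianBundle.exists_contMDiff (IB := 𝓡 d) (n := ∞)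
      (F := EuclideanSpace ℝ (Fin d)) (E := fun x : M => TangentSpace (𝓡 d) x)
    exact ⟨g, hg.continuous, hinner⟩
  exact (continuousOn_coordVector p i).inner_bundle (continuousOn_coordVector p j)

omit [RiemannianBundle (fun x : M => TangentSpace (𝓡 d) x)] in
lemma linearIndependent_coordVector (p : M) {y : EuclideanSpace ℝ (Fin d)}
    (hy : y ∈ (extChartAt (𝓡 d) p).target) : LinearIndependent ℝ (coordVector p y) := by
  have hinv := isInvertible_mfderivWithin_extChartAt_symm (I := 𝓡 d) hy
  rw [ModelWithCorners.range_eq_univ, mfderivWithin_univ] at hinv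
  have hli : LinearIndependent ℝ
      (fun i : Fin d => (EuclideanSpace.single i (1 : ℝ) : EuclideanSpace ℝ (Fin d))) := by
    have hb := (EuclideanSpace.basisFun (Fin d) ℝ).toBasis.linearIndependent
    have heq : (fun i : Fin d => (EuclideanSpace.single i (1 : ℝ) : EuclideanSpace ℝ (Fin d))) =
        (EuclideanSpace.basisFun (Fin d) ℝ).toBasis := by ext i : 1; simp
    rw [heq]
    exact hb
  exact hli.map' _ (LinearMap.ker_eq_bot.2 hinv.injective)

lemma det_metricMatrix_pos (p : M) {y : EuclideanSpace ℝ (Fin d)}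
    (hy : y ∈ (extChartAt (𝓡 d) p).target) : 0 < (metricMatrix p y).det := by
  have hpd : (Matrix.gram ℝ (coordVector p y)).PosDef :=
    Matrix.posDef_gram_of_linearIndependent (linearIndependent_coordVector p hy)
  have heq : metricMatrix p y = Matrix.gram ℝ (coordVector p y) := rfl
  rw [heq]
  exact hpd.det_pos

/-- In the chart around `p`, `U` becomes a nonempty open set, and the density `√(det g_ij)` is
positive there because `(g_ij)` is a Gram matrix of independent vectors. -/
lemma chartVolume_pos [MeasurableSpace M] [BorelSpace M]
    [IsContMDiffRiemannianBundle (𝓡 d) ∞ (EuclideanSpace ℝ (Fin d))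
      (fun x : M => TangentSpace (𝓡 d) x)] {p : M} {U : Set M} (hU : IsOpen U) (hp : p ∈ U) :
    0 < chartVolume (d := d) p U := by
  set φ := extChartAt (𝓡 d) p
  have htarget : IsOpen φ.target := isOpen_extChartAt_target p
  have hcont : ContinuousOn φ.symm φ.target := continuousOn_extChartAt_symm p
  have hdens : AEMeasurable (fun y => ENNReal.ofReal (Real.sqrt (metricMatrix p y).det))
      (volume.restrict φ.target) := by
    refine ContinuousOn.aemeasurable ?_ htarget.measurableSet
    have hdet : ContinuousOn (fun y => (metricMatrix p y).det) φ.target :=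
      (Continuous.matrix_det continuous_id).comp_continuousOn (continuousOn_metricMatrix p)
    exact ENNReal.continuous_ofReal.comp_continuousOn
      (Real.continuous_sqrt.comp_continuousOn hdet)
  have hsymm : AEMeasurable φ.symm (volume.restrict φ.target) :=
    hcont.aemeasurable htarget.measurableSet
  have hV : IsOpen (φ.target ∩ φ.symm ⁻¹' U) := hcont.isOpen_inter_preimage htarget hU
  have hV0 : volume (φ.target ∩ φ.symm ⁻¹' U) ≠ 0 := by
    have hne : (φ.target ∩ φ.symm ⁻¹' U).Nonempty :=
      ⟨φ p, mem_extChartAt_target p, by simpa [φ] using hp⟩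
    exact (hV.measure_pos volume hne).ne'
  -- The inverse chart is controlled only on its target, hence a.e. measurability rather than
  -- measurability.
  rw [chartVolume, Measure.map_apply_of_aemeasurable
    (hsymm.mono_ac (withDensity_absolutelyContinuous _ _)) hU.measurableSet, pos_iff_ne_zero]
  refine fun h0 => hV0 ?_
  have h1 : ((volume.restrict φ.target).withDensity
      (fun y => ENNReal.ofReal (Real.sqrt (metricMatrix p y).det)))
        (φ.target ∩ φ.symm ⁻¹' U) = 0 := measure_mono_null inter_subset_right h0
  rw [withDensity_apply_eq_zero' hdens] at h1
  rw [Measure.restrict_apply' htarget.measurableSet] at h1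
  refine measure_mono_null ?_ h1
  refine fun y hy => ⟨⟨?_, hy⟩, hy.1⟩
  exact (ENNReal.ofReal_pos.2 (Real.sqrt_pos.2 (det_metricMatrix_pos p hy.1))).ne'

lemma riemannianVolume_pos [MeasurableSpace M] [BorelSpace M]
    [IsContMDiffRiemannianBundle (𝓡 d) ∞ (EuclideanSpace ℝ (Fin d))
      (fun x : M => TangentSpace (𝓡 d) x)] {U : Set M} (hU : IsOpen U) (hne : U.Nonempty) :
    0 < riemannianVolume d M U := by
  obtain ⟨p, hp⟩ := hne
  exact (chartVolume_pos hU hp).trans_le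
    (le_iSup (fun q : M => chartVolume (d := d) q) p U)

end Volume

/-! ### Packing and covering by balls in a metric measure space. -/

section Packing

variable {X : Type*} [EMetricSpace X]

lemma geodesicBall_eq_eball (x : X) (r : ℝ) :
    geodesicBall x r = Metric.eball x (ENNReal.ofReal r) := rfl

lemma coveringNumber_ne_top [CompactSpace X] {ε : ℝ} (hε : 0 < ε) : coveringNumber X ε ≠ ⊤ := by
  obtain ⟨t, ht⟩ := isCompact_univ.elim_finite_subcover (fun x : X => geodesicBall x ε)
    (fun x => by rw [geodesicBall_eq_eball]; exact Metric.isOpen_eball)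
    (fun x _ => mem_iUnion.2 ⟨x, by
      rw [geodesicBall_eq_eball]; exact Metric.mem_eball_self (ENNReal.ofReal_pos.2 hε)⟩)
  have hle : coveringNumber X ε ≤ (t : Set X).encard :=
    iInf₂_le (t : Set X) (by simpa [univ_subset_iff] using ht)
  exact (hle.trans_lt (by simp)).ne

/-- Finitely many balls of radius r/2 cover, and every ball of radius r contains one of them. -/
lemma iInf_measure_geodesicBall_pos [CompactSpace X] [Nonempty X] [MeasurableSpace X]
    (μ : Measure X) [μ.IsOpenPosMeasure] {r : ℝ} (hr : 0 < r) :
    0 < ⨅ x : X, μ (geodesicBall x r) := by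
  have hr2 : 0 < ENNReal.ofReal (r / 2) := ENNReal.ofReal_pos.2 (half_pos hr)
  obtain ⟨t, ht⟩ := isCompact_univ.elim_finite_subcover
    (fun x : X => Metric.eball x (ENNReal.ofReal (r / 2))) (fun x => Metric.isOpen_eball)
    (fun x _ => mem_iUnion.2 ⟨x, Metric.mem_eball_self hr2⟩)
  have hmin : 0 < t.inf fun x => μ (Metric.eball x (ENNReal.ofReal (r / 2))) :=
    (Finset.lt_inf_iff ENNReal.zero_lt_top).2 fun x _ =>
      Metric.isOpen_eball.measure_pos μ ⟨x, Metric.mem_eball_self hr2⟩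
  refine hmin.trans_le (le_iInf fun y => ?_)
  obtain ⟨x, hx, hyx⟩ : ∃ x ∈ t, y ∈ Metric.eball x (ENNReal.ofReal (r / 2)) := by
    simpa using ht (mem_univ y)
  refine (Finset.inf_le hx).trans (measure_mono fun z hz => ?_)
  calc edist z y ≤ edist z x + edist y x := edist_triangle_right z y x
    _ < ENNReal.ofReal (r / 2) + ENNReal.ofReal (r / 2) := ENNReal.add_lt_add hz hyx
    _ = ENNReal.ofReal r := by
      rw [← ENNReal.ofReal_add (half_pos hr).le (half_pos hr).le, add_halves]

lemma disjoint_geodesicBall_half {ε : ℝ} (hε : 0 < ε) {x y : X}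
    (hxy : ENNReal.ofReal ε ≤ edist x y) :
    Disjoint (geodesicBall x (ε / 2)) (geodesicBall y (ε / 2)) := by
  refine Set.disjoint_left.2 fun z hzx hzy => hxy.not_gt ?_
  calc edist x y ≤ edist z x + edist z y := edist_triangle_left x y z
    _ < ENNReal.ofReal (ε / 2) + ENNReal.ofReal (ε / 2) := ENNReal.add_lt_add hzx hzy
    _ = ENNReal.ofReal ε := by
      rw [← ENNReal.ofReal_add (half_pos hε).le (half_pos hε).le, add_halves]

/-- The volume of a separated set of centres is bounded by the total volume. -/
lemma card_mul_iInf_measure_le [MeasurableSpace X] [OpensMeasurableSpace X] (μ : Measure X)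
    {ε : ℝ} (hε : 0 < ε) (s : Finset X)
    (hs : (s : Set X).Pairwise fun x y => ENNReal.ofReal ε ≤ edist x y) :
    (s.card : ℝ≥0∞) * ⨅ x : X, μ (geodesicBall x (ε / 2)) ≤ μ univ := by
  calc (s.card : ℝ≥0∞) * ⨅ x : X, μ (geodesicBall x (ε / 2))
      = ∑ _x ∈ s, ⨅ x : X, μ (geodesicBall x (ε / 2)) := by simp
    _ ≤ ∑ x ∈ s, μ (geodesicBall x (ε / 2)) := Finset.sum_le_sum fun x _ => iInf_le _ x
    _ = μ (⋃ x ∈ s, geodesicBall x (ε / 2)) :=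
        (measure_biUnion_finset (fun x hx y hy hxy => disjoint_geodesicBall_half hε (hs hx hy hxy))
          fun x _ => by
            rw [geodesicBall_eq_eball]; exact Metric.isOpen_eball.measurableSet).symm
    _ ≤ μ univ := measure_mono (subset_univ _)

/-- The covering number is at most the total volume divided by the least volume of a ball of half
the radius: the balls around a maximal separated set cover. -/
lemma coveringNumber_toNat_mul_iInf_measure_le [MeasurableSpace X] [OpensMeasurableSpace X]
    (μ : Measure X) {ε : ℝ} (hε : 0 < ε) (hfin : μ univ ≠ ⊤)
    (hpos : 0 < ⨅ x : X, μ (geodesicBall x (ε / 2))) :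
    ((coveringNumber X ε).toNat : ℝ≥0∞) * ⨅ x : X, μ (geodesicBall x (ε / 2)) ≤ μ univ := by
  classical
  set v := ⨅ x : X, μ (geodesicBall x (ε / 2))
  let S : Set ℕ := {n | ∃ s : Finset X, s.card = n ∧
    (s : Set X).Pairwise fun x y => ENNReal.ofReal ε ≤ edist x y}
  -- The volume bound on separated sets makes a largest one exist.
  have hbdd : BddAbove S := by
    obtain ⟨K, hK⟩ := ENNReal.exists_nat_gt (ENNReal.div_ne_top hfin hpos.ne')
    refine ⟨K, ?_⟩
    rintro n ⟨s, rfl, hs⟩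
    have hle := ENNReal.le_div_iff_mul_le (Or.inl hpos.ne') (Or.inr hfin) |>.2
      (card_mul_iInf_measure_le μ hε s hs)
    exact_mod_cast (hle.trans_lt hK).le
  obtain ⟨s, hcard, hs⟩ : sSup S ∈ S := Nat.sSup_mem ⟨0, ∅, by simp⟩ hbdd
  have hcover : (⋃ x ∈ (s : Set X), geodesicBall x ε) = univ := by
    refine eq_univ_of_forall fun y => ?_
    by_contra hy
    have hfar : ∀ x ∈ s, ENNReal.ofReal ε ≤ edist y x := by
      simpa [geodesicBall] using hy
    have hys : y ∉ s := fun hmem =>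
      (ENNReal.ofReal_pos.2 hε).not_ge (by simpa using hfar y hmem)
    have hmem : (insert y s).card ∈ S := by
      refine ⟨insert y s, rfl, ?_⟩
      rw [Finset.coe_insert]
      exact hs.insert fun x hx _ => ⟨hfar x hx, by rw [edist_comm]; exact hfar x hx⟩
    have hle := le_csSup hbdd hmem
    rw [Finset.card_insert_of_notMem hys, hcard] at hle
    omega
  have hN : (coveringNumber X ε).toNat ≤ s.card := by
    refine ENat.toNat_le_of_le_natCast ?_
    rw [← Set.encard_coe_eq_coe_finsetCard]
    exact iInf₂_le (s : Set X) hcover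
  exact (mul_le_mul_left (by exact_mod_cast hN) v).trans (card_mul_iInf_measure_le μ hε s hs)

lemma log_coveringNumber_le [Nonempty X] [MeasurableSpace X] [OpensMeasurableSpace X]
    (μ : Measure X) {ε : ℝ} (hε : 0 < ε) (hfin : μ univ ≠ ⊤)
    (hpos : 0 < ⨅ x : X, μ (geodesicBall x (ε / 2))) :
    Real.log ((coveringNumber X ε).toNat : ℝ) ≤
      Real.log ((μ univ).toReal / (⨅ x : X, μ (geodesicBall x (ε / 2))).toReal) := by
  have hN := coveringNumber_toNat_mul_iInf_measure_le μ hε hfin hpos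
  set v := ⨅ x : X, μ (geodesicBall x (ε / 2))
  have hv : v ≤ μ univ :=
    (iInf_le _ (Classical.arbitrary X)).trans (measure_mono (subset_univ _))
  have hv0 : 0 < v.toReal := ENNReal.toReal_pos hpos.ne' (ne_top_of_le_ne_top hfin hv)
  have hmul : ((coveringNumber X ε).toNat : ℝ) * v.toReal ≤ (μ univ).toReal := by
    simpa using ENNReal.toReal_mono hfin hN
  -- If `toNat` is zero, the left side is `Real.log 0 = 0`, and the quotient on the right is at
  -- least 1.
  rcases Nat.eq_zero_or_pos (coveringNumber X ε).toNat with h0 | h0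
  · rw [h0, Nat.cast_zero, Real.log_zero]
    exact Real.log_nonneg ((one_le_div hv0).2 (ENNReal.toReal_mono hfin hv))
  · exact Real.log_le_log (by exact_mod_cast h0) ((le_div_iff₀ hv0).2 hmul)

end Packing

end RiemannianCovering

theorem theorem1 :
    ∃ c : ℝ, 0 < c ∧
      ∀ (d : ℕ) (M : Type*) [EMetricSpace M] [CompactSpace M] [Nonempty M]
        [ChartedSpace (EuclideanSpace ℝ (Fin d)) M] [IsManifold (𝓡 d) ∞ M]
        [RiemannianBundle (fun x : M => TangentSpace (𝓡 d) x)]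
        [IsContMDiffRiemannianBundle (𝓡 d) ∞ (EuclideanSpace ℝ (Fin d))
          (fun x : M => TangentSpace (𝓡 d) x)]
        [IsRiemannianManifold (𝓡 d) M]
        [MeasurableSpace M] [BorelSpace M]
        (κmin κmax : ℝ)
        (_hsec : ∀ (p : M) (u v : TangentSpace (𝓡 d) p), LinearIndependent ℝ ![u, v] →
          κmin ≤ RiemannianCovering.sectionalCurvature p u v ∧
            RiemannianCovering.sectionalCurvature p u v ≤ κmax)
        (_hinj : 0 < RiemannianCovering.injRadius d M)
        (_hvol : RiemannianCovering.riemannianVolume d M Set.univ < ⊤)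
        (ε : ℝ) (_hε : 0 < ε) (_hεinj : ENNReal.ofReal ε < RiemannianCovering.injRadius d M / 2),
        RiemannianCovering.coveringNumber M ε ≠ ⊤ ∧
        0 < ⨅ x : M, RiemannianCovering.riemannianVolume d M
          (RiemannianCovering.geodesicBall x (ε / 2)) ∧
        Real.log ((RiemannianCovering.coveringNumber M ε).toNat : ℝ) ≤
          Real.log ((RiemannianCovering.riemannianVolume d M Set.univ).toReal /
            (⨅ x : M, RiemannianCovering.riemannianVolume d M
              (RiemannianCovering.geodesicBall x (ε / 2))).toReal)
          + c * d * Real.sqrt |κmax| * ε := by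
  -- Any positive constant would do.
  refine ⟨1, one_pos, ?_⟩
  intro d M _ _ _ _ _ _ _ _ _ _ κmin κmax _ _ hvol ε hε _
  have : (RiemannianCovering.riemannianVolume d M).IsOpenPosMeasure :=
    ⟨fun _ hU hne => (RiemannianCovering.riemannianVolume_pos hU hne).ne'⟩
  have hpos := RiemannianCovering.iInf_measure_geodesicBall_pos
    (RiemannianCovering.riemannianVolume d M) (half_pos hε)
  refine ⟨RiemannianCovering.coveringNumber_ne_top hε, hpos, ?_⟩
  refine (RiemannianCovering.log_coveringNumber_le _ hε hvol.ne hpos).trans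
    (le_add_of_nonneg_right ?_)
  positivity
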